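/- Let $q$ be a prime power and let $V$ be a finite-dimensional vector space over $\mathbb{F}_q$, of dimension $n$, equipped with a non-degenerate alternating bilinear form, a non-degenerate quadratic form, or a non-degenerate Hermitian form (with respect to a field automorphism of order $2$; then $q$ is a square). A subspace of $V$ is totally isotropic if the form vanishes identically on it. Let $\mathcal P$ be the classical polar space consisting of all totally isotropic subspaces of $V$, let $d$ be its Witt index, that is, the largest dimension of a totally isotropic subspace, and assume $d\ge 1$. The points of $\mathcal P$ are its $1$-dimensional members and the generators are its $d$-dimensional members. Put $e=1$ in the symplectic case, $e=n-2d\in\{0,1,2\}$ in the orthogonal (quadratic) case, and $e=n-2d+\tfrac12\in\{\tfrac12,\tfrac32\}$ in the Hermitian case. The dual polar graph $\Gamma(q,d,e)$ of $\mathcal P$ has the generators as vertices, two being adjacent if and only if their intersection has dimension $d-1$. The metric dimension $\mu(\Gamma)$ of a finite connected graph $\Gamma$ is the smallest size of a set $S$ of vertices such that any two distinct vertices $u,w$ satisfy $\mathrm{d}(u,x)\ne \mathrm{d}(w,x)$ for some $x\in S$. Let $M$ be the $0/1$ incidence matrix with rows indexed by the generators and columns by the points of $\mathcal P$, with entry $1$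 exactly when the point is contained in the generator. **Theorem.** The metric dimension of $\Gamma(q,d,e)$ is at most the rank of $M$ over $\mathbb{R}$, that is, $$\mu(\Gamma(q,d,e))\;\le\;\operatorname{rank}_{\mathbb R}(M)\;=\;\frac{(q^{d+e-1}+1)(q^{d+e-1}-q^{e-1}+q-1)}{(q^{e-1}+1)(q-1)}.$$ -/

import Mathlib

/-- A set `S` of vertices is resolving if any two distinct vertices are told apart by their
distance to some member of `S`. The distance is the length of a shortest path, with value `⊤` if
there is none; in a connected graph it is the usual integer-valued distance. -/
def IsResolvingSet {V : Type*} (G : SimpleGraph V) (S : Set V) : Prop :=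
  ∀ u w : V, u ≠ w → ∃ x ∈ S, G.edist u x ≠ G.edist w x

/-- The metric dimension of a finite graph: the smallest size of a resolving set. (The set of all
vertices is resolving, so the infimum is a minimum.) -/
noncomputable def metricDimension {V : Type*} [Finite V] (G : SimpleGraph V) : ℕ :=
  sInf {k : ℕ | ∃ S : Finset V, IsResolvingSet G (S : Set V) ∧ S.card = k}

/-- A classical polar space on the vector space `V` over `F`, given by the form defining it:
a non-degenerate alternating bilinear form, a non-degenerate quadratic form (in any
characteristic), or a non-degenerate Hermitian form with respect to a field automorphism `σ` of
order two. -/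
inductive ClassicalPolarSpace (F V : Type*) [Field F] [AddCommGroup V] [Module F V]
  | symplectic (B : LinearMap.BilinForm F V) (alt : LinearMap.IsAlt B)
      (nondeg : LinearMap.Nondegenerate B)
  | orthogonal (Q : QuadraticForm F V) (nondeg : QuadraticMap.Nondegenerate (Q := Q))
  | hermitian (σ : F →+* F) (σ_ne : σ ≠ RingHom.id F) (σ_invol : ∀ a, σ (σ a) = a)
      (H : V →ₛₗ[σ] V →ₗ[F] F) (herm : LinearMap.IsSymm H) (nondeg : LinearMap.Nondegenerate H)

namespace ClassicalPolarSpace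

variable {F V : Type*} [Field F] [AddCommGroup V] [Module F V]

/-- Totally isotropic subspaces: the form vanishes identically on `U`. -/
def IsTotallyIsotropic : ClassicalPolarSpace F V → Submodule F V → Prop
  | symplectic B _ _, U => ∀ v ∈ U, ∀ w ∈ U, B v w = 0
  | orthogonal Q _, U => ∀ v ∈ U, Q v = 0
  | hermitian _ _ _ H _ _, U => ∀ v ∈ U, ∀ w ∈ U, H v w = 0

/-- The Witt index: the largest dimension of a totally isotropic subspace. -/
noncomputable def wittIndex (P : ClassicalPolarSpace F V) : ℕ :=
  sSup {k : ℕ | ∃ U : Submodule F V, P.IsTotallyIsotropic U ∧ Module.finrank F U = k}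

/-- The parameter `e` of a polar space of Witt index `d` on a space of dimension `n`. It is `1` for
symplectic spaces (where `n = 2d`). For orthogonal spaces it is `n - 2d`: `0` for hyperbolic
quadrics (`n = 2d`), `1` for parabolic quadrics (`n = 2d + 1`), `2` for elliptic quadrics
(`n = 2d + 2`). For Hermitian spaces it is `n - 2d + 1/2`: `1/2` if `n = 2d` and `3/2` if
`n = 2d + 1`. -/
noncomputable def parameterE : ClassicalPolarSpace F V → ℝ
  | symplectic _ _ _ => 1
  | P@(orthogonal _ _) => (Module.finrank F V : ℝ) - 2 * (P.wittIndex : ℝ)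
  | P@(hermitian _ _ _ _ _ _) => (Module.finrank F V : ℝ) - 2 * (P.wittIndex : ℝ) + 1 / 2

/-- The totally isotropic subspaces of dimension `t`. -/
def Omega (P : ClassicalPolarSpace F V) (t : ℕ) : Type _ :=
  {U : Submodule F V // P.IsTotallyIsotropic U ∧ Module.finrank F U = t}

/-- The points of the polar space. -/
abbrev Point (P : ClassicalPolarSpace F V) : Type _ := P.Omega 1

/-- The generators (maximals) of the polar space. -/
abbrev Generator (P : ClassicalPolarSpace F V) : Type _ := P.Omega P.wittIndex

instance finite_Omega [Finite F] [FiniteDimensional F V] (P : ClassicalPolarSpace F V) (t : ℕ) :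
    Finite (P.Omega t) := by
  have : Finite V := Module.finite_of_finite F
  have : Finite (Submodule F V) := Finite.of_injective _ (SetLike.coe_injective (A := Submodule F V))
  exact Subtype.finite

noncomputable instance fintype_Omega [Finite F] [FiniteDimensional F V]
    (P : ClassicalPolarSpace F V) (t : ℕ) : Fintype (P.Omega t) :=
  Fintype.ofFinite _

/-- The dual polar graph: two generators are adjacent if and only if their intersection has
dimension one less than the Witt index. -/
def dualPolarGraph (P : ClassicalPolarSpace F V) : SimpleGraph P.Generator where
  Adj U W := Module.finrank F (U.1 ⊓ W.1 : Submodule F V) + 1 = P.wittIndex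
  symm := ⟨fun U W h => by rwa [inf_comm]⟩
  loopless := ⟨fun U h => by
    have := U.2.2
    rw [inf_idem] at h
    omega⟩

open Classical in
/-- The incidence matrix of the polar space: rows are indexed by generators, columns by points. -/
noncomputable def incidenceMatrix (P : ClassicalPolarSpace F V) :
    Matrix P.Generator P.Point ℝ :=
  fun U x => if x.1 ≤ U.1 then 1 else 0

end ClassicalPolarSpace

/-! The inequality is linear algebra. Each generator gives the 0/1 row of the isotropic vectors it
contains, and the inner product of the rows of `U` and `W` is `q ^ dim (U ⊓ W) - 1`, which depends
only on the distance of `U` and `W` in the dual polar graph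
(`edist_dualPolarGraph_add_finrank_inf`). Take generators whose rows form a basis of the row space.
If `U` and `W` have the same distance to each of them, then row `U` minus row `W` is orthogonal to
the row space, hence to itself, so the rows agree and `U = W`.

For the rank, let `M` be the matrix on vectors. The number of generators through two points depends
only on whether the points are equal, orthogonal and distinct, or non-orthogonal, which gives `Mᵀ M
Mᵀ = λ Mᵀ + κ J` with `J` the all-one matrix. Since row and column sums of `M` are constant, a
combination `K` of `M` and `J` satisfies `Mᵀ K Mᵀ = Mᵀ`. So `Mᵀ K` is idempotent, and the rank is
its trace.

The counts treat the three types of form together. The only numerical input from the form is `τ`,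
the number of isotropic points other than `⟨u⟩` on a line through an isotropic point `⟨u⟩` and not
in its perp. Double counting then yields the number of points and of generators in every residue,
without Witt's theorem or a classification of forms. -/

namespace ClassicalPolarSpace

/-! ### The three types of form and their constant `τ`. -/

section Form

variable {F V : Type*} [Field F] [AddCommGroup V] [Module F V]

/-- The data common to the three types of classical polar spaces: a reflexive sesquilinear form
together with a set of isotropic vectors, such that every hyperbolic line carries a constant number
of isotropic points. -/
structure PolarForm (P : ClassicalPolarSpace F V) where
  /-- The companion automorphism. -/
  σ : F →+* F
  σ_invol : ∀ a, σ (σ a) = a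
  /-- The sesquilinear form. -/
  B : V →ₛₗ[σ] V →ₗ[F] F
  /-- The isotropic vectors. -/
  Iso : V → Prop
  /-- The number of isotropic points, other than `⟨u⟩`, on a line through an isotropic `u` not
  contained in the perp of `u`. -/
  τ : ℕ
  symm : ∀ v w, B v w = 0 → B w v = 0
  self : ∀ v, Iso v → B v v = 0
  iso_smul : ∀ (c : F) (v), Iso v → Iso (c • v)
  iso_add : ∀ v w, Iso v → Iso w → B v w = 0 → Iso (v + w)
  isTI_iff : ∀ U : Submodule F V, P.IsTotallyIsotropic U ↔
    (∀ v ∈ U, Iso v) ∧ ∀ v ∈ U, ∀ w ∈ U, B v w = 0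
  card_iso : ∀ u v, Iso u → B u v ≠ 0 → Nat.card {t : F // Iso (v + t • u)} = τ
  nondeg : ∀ u, Iso u → (∀ v, B u v = 0) → u = 0

/-- The polar form of an alternating form. -/
noncomputable def symplecticPolarForm (B : LinearMap.BilinForm F V) (alt : LinearMap.IsAlt B)
    (nondeg : LinearMap.Nondegenerate B) : PolarForm (symplectic B alt nondeg) where
  σ := RingHom.id F
  σ_invol _ := rfl
  B := B
  Iso _ := True
  τ := Nat.card F
  symm v w h := alt.isRefl v w h
  self v _ := alt v
  iso_smul _ _ _ := trivial
  iso_add _ _ _ _ _ := trivial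
  isTI_iff U := by simp [IsTotallyIsotropic]
  card_iso u v _ _ := Nat.card_congr (Equiv.subtypeUnivEquiv fun _ => trivial)
  nondeg u _ h := nondeg.1 u h

/-- The polar form of a quadratic form. -/
noncomputable def orthogonalPolarForm (Q : QuadraticForm F V)
    (nondeg : QuadraticMap.Nondegenerate (Q := Q)) : PolarForm (orthogonal Q nondeg) where
  σ := RingHom.id F
  σ_invol _ := rfl
  B := Q.polarBilin
  Iso v := Q v = 0
  τ := 1
  symm v w h := by
    simpa [QuadraticMap.polar_comm Q w v] using h
  self v h := by simp [h]
  iso_smul c v h := by simp [QuadraticMap.map_smul, h]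
  iso_add v w hv hw h := by
    rw [QuadraticMap.map_add Q, hv, hw]
    simpa using h
  isTI_iff U := by
    refine ⟨fun h => ⟨h, fun v hv w hw => ?_⟩, fun h => h.1⟩
    have h1 : Q (v + w) = 0 := h _ (U.add_mem hv hw)
    have h2 : Q v = 0 := h _ hv
    have h3 : Q w = 0 := h _ hw
    simp [QuadraticMap.polar, h1, h2, h3]
  card_iso u v hu h := by
    replace h : QuadraticMap.polar Q u v ≠ 0 := by simpa using h
    have key : ∀ t : F, Q (v + t • u) = Q v + t * QuadraticMap.polar Q u v := by
      intro t
      rw [QuadraticMap.map_add Q, QuadraticMap.map_smul, QuadraticMap.polar_comm Q v,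
        QuadraticMap.polar_smul_left, hu]
      simp
    rw [Nat.card_eq_one_iff_exists]
    refine ⟨⟨-Q v / QuadraticMap.polar Q u v, ?_⟩, fun t => Subtype.ext ?_⟩
    · rw [key, div_mul_cancel₀ _ h, add_neg_cancel]
    · have ht := t.2
      rw [key] at ht
      rw [eq_div_iff h]
      linear_combination ht
  nondeg u hu h := by
    have : u ∈ Q.radical := by
      rw [QuadraticMap.mem_radical_iff']
      refine ⟨hu, fun v => ?_⟩
      have := h v
      rw [QuadraticMap.map_add Q, hu]
      simpa using this
    rwa [nondeg.radical_eq_bot, Submodule.mem_bot] at this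

/-- The equation `h + (t c + σ (t c)) = 0`, with `h` fixed by the involution `σ` and `c ≠ 0`, has as
many solutions `t` as there are elements of trace zero. -/
theorem card_trace_fiber (σ : F →+* F) (σ_ne : σ ≠ RingHom.id F)
    (σ_invol : ∀ a, σ (σ a) = a) (h : F) (hh : σ h = h) (c : F) (hc : c ≠ 0) :
    Nat.card {t : F // h + (t * c + σ (t * c)) = 0} = Nat.card {s : F // s + σ s = 0} := by
  -- If the trace vanished identically, its value at `1` would give `2 = 0`, and then `σ x = -x = x`
  -- for all `x`.
  obtain ⟨s₀, hs₀⟩ : ∃ s, s + σ s ≠ 0 := by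
    by_contra! H
    refine σ_ne (RingHom.ext fun x => ?_)
    have h1 := H 1
    have hx := H x
    rw [map_one] at h1
    rw [RingHom.id_apply]
    linear_combination hx - x * h1
  set r := s₀ + σ s₀ with hr
  have hr' : σ r = r := by rw [hr, map_add, σ_invol, add_comm]
  -- As `h / r` is fixed by `σ`, the element `s₀ * (h / r)` has trace `h`; translating by it moves
  -- the fibre to the kernel.
  refine Nat.card_congr
    { toFun := fun t => ⟨t.1 * c + s₀ * (h / r), ?_⟩
      invFun := fun s => ⟨(s.1 - s₀ * (h / r)) / c, ?_⟩
      left_inv := fun t => Subtype.ext (by field_simp; ring)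
      right_inv := fun s => Subtype.ext (by field_simp; ring) }
  · have := t.2
    have e : σ (s₀ * (h / r)) = σ s₀ * (h / r) := by rw [map_mul, map_div₀, hh, hr']
    have e2 : (s₀ + σ s₀) * (h / r) = h := by rw [← hr]; field_simp
    rw [map_add, e]
    linear_combination this + e2
  · have := s.2
    have e : σ (s₀ * (h / r)) = σ s₀ * (h / r) := by rw [map_mul, map_div₀, hh, hr']
    have e2 : (s₀ + σ s₀) * (h / r) = h := by rw [← hr]; field_simp
    rw [div_mul_cancel₀ _ hc, map_sub, e]
    linear_combination this - e2

/-- The number of elements of trace zero is the square root of the order of the field. -/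
theorem card_trace_ker_sq [Finite F] (σ : F →+* F) (σ_ne : σ ≠ RingHom.id F)
    (σ_invol : ∀ a, σ (σ a) = a) :
    Nat.card {s : F // s + σ s = 0} ^ 2 = Nat.card F := by
  let Tr : F →+ F := AddMonoidHom.id F + σ.toAddMonoidHom
  have hTr : ∀ x, Tr x = x + σ x := fun x => rfl
  have hfib : ∀ x : F, x ∈ Tr.range ↔ σ x = x := by
    intro x
    constructor
    · rintro ⟨y, rfl⟩
      rw [hTr, map_add, σ_invol, add_comm]
    · intro hx
      have h1 := card_trace_fiber σ σ_ne σ_invol (-x) (by rw [map_neg, hx]) 1 one_ne_zero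
      have h2 : 0 < Nat.card {s : F // s + σ s = 0} :=
        Nat.card_pos_iff.2 ⟨⟨0, by simp⟩, inferInstance⟩
      rw [← h1] at h2
      obtain ⟨⟨t, ht⟩⟩ := (Nat.card_pos_iff.1 h2).1
      refine ⟨t, ?_⟩
      rw [hTr]
      rw [mul_one] at ht
      linear_combination ht
  obtain ⟨a, ha⟩ : ∃ a, σ a ≠ a := by
    by_contra! H
    exact σ_ne (RingHom.ext H)
  have hb : a - σ a ≠ 0 := fun h => ha (sub_eq_zero.1 h).symm
  have hb' : σ (a - σ a) = -(a - σ a) := by rw [map_sub, σ_invol]; ring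
  -- The range is the fixed field, and `a - σ a` is negated by `σ`, so multiplication by it maps the
  -- range bijectively onto the kernel.
  have e1 : Nat.card Tr.range = Nat.card {s : F // s + σ s = 0} :=
    Nat.card_congr
      { toFun := fun t => ⟨t.1 * (a - σ a), by
          rw [map_mul, hb', (hfib _).1 t.2]; ring⟩
        invFun := fun s => ⟨s.1 / (a - σ a), by
          rw [hfib, map_div₀, hb', eq_neg_of_add_eq_zero_right s.2, neg_div_neg_eq]⟩
        left_inv := fun t => Subtype.ext (by field_simp)
        right_inv := fun s => Subtype.ext (by field_simp) }
  have e2 : Nat.card Tr.ker = Nat.card {s : F // s + σ s = 0} := rfl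
  have e3 := AddSubgroup.card_eq_card_quotient_mul_card_addSubgroup Tr.ker
  rw [Nat.card_congr (QuotientAddGroup.quotientKerEquivRange Tr).toEquiv, e1, e2] at e3
  rw [e3, sq]

/-- The polar form of a Hermitian form. -/
noncomputable def hermitianPolarForm [Finite F] (σ : F →+* F) (σ_ne : σ ≠ RingHom.id F)
    (σ_invol : ∀ a, σ (σ a) = a) (H : V →ₛₗ[σ] V →ₗ[F] F) (herm : LinearMap.IsSymm H)
    (nondeg : LinearMap.Nondegenerate H) :
    PolarForm (hermitian σ σ_ne σ_invol H herm nondeg) where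
  σ := σ
  σ_invol := σ_invol
  B := H
  Iso v := H v v = 0
  τ := Nat.card {s : F // s + σ s = 0}
  symm v w h := herm.isRefl v w h
  self _ h := h
  iso_smul c v h := by simp [h]
  iso_add v w hv hw h := by simp [hv, hw, h, herm.isRefl v w h]
  isTI_iff U := ⟨fun h => ⟨fun v hv => h v hv v hv, h⟩, fun h => h.2⟩
  card_iso u v hu h := by
    rw [← card_trace_fiber σ σ_ne σ_invol (H v v) (herm.eq v v) (H v u)
      (fun h' => h (herm.isRefl _ _ h'))]
    refine Nat.card_congr (Equiv.subtypeEquivRight fun t => ?_)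
    have : σ (H v u) = H u v := herm.eq v u
    simp [hu, this, add_assoc]
  nondeg u _ h := nondeg.1 u h

end Form

end ClassicalPolarSpace

namespace ClassicalPolarSpace

/-! ### Generators and distances in the dual polar graph. -/

section Generators

open Module Submodule

variable {F V : Type*} [Field F] [AddCommGroup V] [Module F V]

variable {P : ClassicalPolarSpace F V}

theorem isTotallyIsotropic_bot (P : ClassicalPolarSpace F V) : P.IsTotallyIsotropic ⊥ := by
  cases P <;> simp [IsTotallyIsotropic]

namespace PolarForm

theorem isTI_mono (D : PolarForm P) {T U : Submodule F V} (hU : P.IsTotallyIsotropic U) (h : T ≤ U) :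
    P.IsTotallyIsotropic T := by
  rw [D.isTI_iff] at hU ⊢
  exact ⟨fun v hv => hU.1 v (h hv), fun v hv w hw => hU.2 v (h hv) w (h hw)⟩

/-- The subspace orthogonal to `T`. -/
def perp (D : PolarForm P) (T : Submodule F V) : Submodule F V where
  carrier := {w | ∀ v ∈ T, D.B v w = 0}
  add_mem' ha hb v hv := by rw [map_add, ha v hv, hb v hv, add_zero]
  zero_mem' v _ := map_zero _
  smul_mem' c w hw v hv := by rw [map_smul, hw v hv, smul_zero]

theorem mem_perp (D : PolarForm P) {T : Submodule F V} {w : V} : w ∈ D.perp T ↔ ∀ v ∈ T, D.B v w = 0 := Iff.rfl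

theorem le_perp (D : PolarForm P) {U : Submodule F V} (hU : P.IsTotallyIsotropic U) : U ≤ D.perp U :=
  fun w hw v hv => ((D.isTI_iff U).1 hU).2 v hv w hw

theorem isTI_sup_span (D : PolarForm P) {T : Submodule F V} (hT : P.IsTotallyIsotropic T) {v : V} (hv : D.Iso v)
    (h : v ∈ D.perp T) : P.IsTotallyIsotropic (T ⊔ span F {v}) := by
  rw [D.isTI_iff] at hT ⊢
  constructor
  · intro x hx
    obtain ⟨y, hy, z, hz, rfl⟩ := Submodule.mem_sup.1 hx
    obtain ⟨c, rfl⟩ := Submodule.mem_span_singleton.1 hz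
    exact D.iso_add _ _ (hT.1 y hy) (D.iso_smul c v hv) (by rw [map_smul, h y hy, smul_zero])
  · intro x hx x' hx'
    obtain ⟨y, hy, z, hz, rfl⟩ := Submodule.mem_sup.1 hx
    obtain ⟨c, rfl⟩ := Submodule.mem_span_singleton.1 hz
    obtain ⟨y', hy', z', hz', rfl⟩ := Submodule.mem_sup.1 hx'
    obtain ⟨c', rfl⟩ := Submodule.mem_span_singleton.1 hz'
    simp [hT.2 y hy y' hy', h y hy, D.symm _ _ (h y' hy'), D.self v hv]

end PolarForm

variable [FiniteDimensional F V]

theorem finrank_inf_ker_add_one (U : Submodule F V) (f : V →ₗ[F] F)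
    (h : ¬ U ≤ LinearMap.ker f) :
    finrank F (U ⊓ LinearMap.ker f : Submodule F V) + 1 = finrank F U := by
  have hne : f.domRestrict U ≠ 0 := by
    intro h0
    refine h fun u hu => ?_
    exact LinearMap.congr_fun h0 ⟨u, hu⟩
  rw [← Module.Dual.finrank_ker_add_one_of_ne_zero hne, LinearMap.ker_domRestrict]
  congr 1
  rw [← Submodule.map_comap_subtype]
  exact (Submodule.equivMapOfInjective _ U.injective_subtype _).finrank_eq.symm

theorem finrank_le_wittIndex {U : Submodule F V} (hU : P.IsTotallyIsotropic U) :
    finrank F U ≤ P.wittIndex :=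
  le_csSup ⟨finrank F V, by rintro k ⟨W, -, rfl⟩; exact W.finrank_le⟩ ⟨U, hU, rfl⟩

theorem nonempty_generator (P : ClassicalPolarSpace F V) : Nonempty P.Generator := by
  obtain ⟨U, hU, h⟩ := Nat.sSup_mem
    (s := {k : ℕ | ∃ U : Submodule F V, P.IsTotallyIsotropic U ∧ finrank F U = k})
    ⟨_, ⊥, P.isTotallyIsotropic_bot, rfl⟩
    ⟨finrank F V, by rintro k ⟨W, -, rfl⟩; exact W.finrank_le⟩
  exact ⟨⟨U, hU, h⟩⟩

namespace PolarForm

/-- The form may be degenerate on `V` (a quadratic form in characteristic two), but no nonzero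
isotropic vector is orthogonal to everything, so `D.B` is injective on `T`. It is only semilinear,
so the dimension of its image is found by comparing cardinalities. -/
theorem finrank_perp (D : PolarForm P) [Finite F] {T : Submodule F V} (hT : P.IsTotallyIsotropic T) :
    finrank F (D.perp T) + finrank F T = finrank F V := by
  have : RingHomSurjective D.σ := ⟨fun a => ⟨D.σ a, D.σ_invol a⟩⟩
  have hV : Finite V := Module.finite_of_finite F
  set Φ : Submodule F (Dual F V) := T.map D.B with hΦ
  have hp : D.perp T = Φ.dualCoannihilator := by
    ext w
    rw [mem_perp, Submodule.mem_dualCoannihilator]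
    constructor
    · rintro h _ ⟨v, hv, rfl⟩
      exact h v hv
    · intro h v hv
      exact h _ ⟨v, hv, rfl⟩
  have hc : Nat.card Φ = Nat.card T := by
    have hinj : Set.InjOn D.B (T : Set V) := by
      intro v hv w hw h
      rw [← sub_eq_zero] at h ⊢
      rw [← map_sub] at h
      exact D.nondeg _ (((D.isTI_iff T).1 hT).1 _ (T.sub_mem hv hw))
        fun x => LinearMap.congr_fun h x
    exact hinj.ncard_image
  rw [Module.natCard_eq_pow_finrank (K := F), Module.natCard_eq_pow_finrank (K := F) (V := T)] at hc
  have hc' := Nat.pow_right_injective (Finite.one_lt_card (α := F)) hc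
  rw [hp, ← hc', add_comm]
  exact Subspace.finrank_add_finrank_dualCoannihilator_eq Φ

/-- Otherwise adjoining `v` would give a totally isotropic subspace of dimension above the Witt
index. -/
theorem mem_of_mem_perp (D : PolarForm P) (U : P.Generator) {v : V} (hv : D.Iso v) (h : v ∈ D.perp U.1) :
    v ∈ U.1 := by
  by_contra hU
  have h1 := finrank_le_wittIndex (D.isTI_sup_span U.2.1 hv h)
  rw [finrank_sup_span_singleton hU, U.2.2] at h1
  omega

theorem not_le_ker (D : PolarForm P) (U : P.Generator) {v : V} (hv : D.Iso v) (h : v ∉ U.1) :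
    ¬ U.1 ≤ LinearMap.ker (D.B v) :=
  fun hle => h (D.mem_of_mem_perp U hv fun _ hu => D.symm _ _ (hle hu))

/-- Replacing a generator by the one spanned by a vector outside it and its perp. -/
theorem exists_generator_exchange (D : PolarForm P) (U : P.Generator) {v : V} (hv : D.Iso v) (h : v ∉ U.1) :
    ∃ W : P.Generator, v ∈ W.1 ∧ U.1 ⊓ LinearMap.ker (D.B v) ≤ W.1 ∧
      P.dualPolarGraph.Adj U W := by
  have h1 := finrank_inf_ker_add_one U.1 _ (D.not_le_ker U hv h)
  have hT := D.isTI_mono U.2.1 (inf_le_left : U.1 ⊓ LinearMap.ker (D.B v) ≤ U.1)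
  have hmem : v ∉ U.1 ⊓ LinearMap.ker (D.B v) := fun h' => h h'.1
  have hd : finrank F (U.1 ⊓ LinearMap.ker (D.B v) ⊔ span F {v} : Submodule F V) = P.wittIndex := by
    rw [finrank_sup_span_singleton hmem, h1, U.2.2]
  let W : P.Generator := ⟨U.1 ⊓ LinearMap.ker (D.B v) ⊔ span F {v},
    D.isTI_sup_span hT hv fun u hu => D.symm _ _ hu.2, hd⟩
  have hvW : v ∈ W.1 := Submodule.mem_sup_right (Submodule.mem_span_singleton_self v)
  refine ⟨W, hvW, le_sup_left, ?_⟩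
  have h2 : U.1 ⊓ LinearMap.ker (D.B v) ≤ U.1 ⊓ W.1 := le_inf inf_le_left le_sup_left
  have h3 : U.1 ⊓ W.1 < W.1 :=
    lt_of_le_of_ne inf_le_right fun h' => h (inf_eq_right.1 h' hvW)
  have h4 := Submodule.finrank_mono h2
  have h5 := Submodule.finrank_lt_finrank_of_lt h3
  rw [W.2.2] at h5
  rw [U.2.2] at h1
  change finrank F (U.1 ⊓ W.1 : Submodule F V) + 1 = P.wittIndex
  omega

/-- Moving a generator one step towards a totally isotropic subspace. -/
theorem exists_adj_inf_lt (D : PolarForm P) (U : P.Generator) {T : Submodule F V} (hT : P.IsTotallyIsotropic T)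
    (h : ¬ T ≤ U.1) : ∃ W : P.Generator, P.dualPolarGraph.Adj U W ∧
      finrank F (U.1 ⊓ T : Submodule F V) < finrank F (W.1 ⊓ T : Submodule F V) := by
  obtain ⟨v, hvT, hvU⟩ := SetLike.not_le_iff_exists.1 h
  rw [D.isTI_iff] at hT
  obtain ⟨W, hvW, hle, hadj⟩ := D.exists_generator_exchange U (hT.1 v hvT) hvU
  refine ⟨W, hadj, Submodule.finrank_lt_finrank_of_lt (lt_of_le_of_ne ?_ ?_)⟩
  · exact fun x hx => ⟨hle ⟨hx.1, hT.2 v hvT x hx.2⟩, hx.2⟩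
  · intro h'
    exact hvU (h'.ge ⟨hvW, hvT⟩ : v ∈ U.1 ⊓ T).1

/-- Exchange steps enlarge the intersection of some generator with `T` until it is all of `T`. Hence
all maximal totally isotropic subspaces have the same dimension. -/
theorem exists_generator_ge (D : PolarForm P) {T : Submodule F V} (hT : P.IsTotallyIsotropic T) :
    ∃ U : P.Generator, T ≤ U.1 := by
  obtain ⟨U₀⟩ := nonempty_generator P
  suffices H : ∀ m : ℕ, ∀ U : P.Generator, finrank F T - finrank F (U.1 ⊓ T : Submodule F V) ≤ m →
      ∃ U : P.Generator, T ≤ U.1 from H _ U₀ le_rfl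
  intro m
  induction m with
  | zero =>
    intro U h
    refine ⟨U, inf_eq_right.1 (Submodule.eq_of_le_of_finrank_le inf_le_right (by omega))⟩
  | succ m ih =>
    intro U h
    by_cases hle : T ≤ U.1
    · exact ⟨U, hle⟩
    · obtain ⟨W, -, hW⟩ := D.exists_adj_inf_lt U hT hle
      exact ih W (by omega)

end PolarForm

/-- For adjacent `U`, `U'`, the subspaces `U ⊓ U'` and `U' ⊓ W` both lie in `U'`, so by the
dimension formula the intersection with `W` loses at most one dimension per step. -/
theorem le_finrank_inf_add_length {U W : P.Generator} (p : P.dualPolarGraph.Walk U W) :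
    P.wittIndex ≤ finrank F (U.1 ⊓ W.1 : Submodule F V) + p.length := by
  induction p with
  | @nil U => rw [inf_idem, U.2.2]; exact Nat.le_add_right _ _
  | @cons U U' W h p ih =>
    change finrank F (U.1 ⊓ U'.1 : Submodule F V) + 1 = P.wittIndex at h
    have h1 := Submodule.finrank_sup_add_finrank_inf_eq (U.1 ⊓ U'.1) (U'.1 ⊓ W.1)
    have h2 : finrank F ((U.1 ⊓ U'.1) ⊔ (U'.1 ⊓ W.1) : Submodule F V) ≤ finrank F U'.1 :=
      Submodule.finrank_mono (sup_le inf_le_right inf_le_left)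
    have h3 : finrank F ((U.1 ⊓ U'.1) ⊓ (U'.1 ⊓ W.1) : Submodule F V) ≤
        finrank F (U.1 ⊓ W.1 : Submodule F V) :=
      Submodule.finrank_mono (inf_le_inf inf_le_left inf_le_right)
    rw [U'.2.2] at h2
    change _ ≤ _ + (p.length + 1)
    omega

theorem exists_walk_length_add_finrank_inf (D : PolarForm P) (U W : P.Generator) :
    ∃ p : P.dualPolarGraph.Walk U W,
      p.length + finrank F (U.1 ⊓ W.1 : Submodule F V) ≤ P.wittIndex := by
  suffices H : ∀ m : ℕ, ∀ U : P.Generator,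
      P.wittIndex - finrank F (U.1 ⊓ W.1 : Submodule F V) = m →
      ∃ p : P.dualPolarGraph.Walk U W,
        p.length + finrank F (U.1 ⊓ W.1 : Submodule F V) ≤ P.wittIndex from H _ U rfl
  intro m
  induction m using Nat.strong_induction_on with
  | _ m ih =>
    intro U hm
    by_cases hle : W.1 ≤ U.1
    · obtain rfl : W = U :=
        Subtype.ext (Submodule.eq_of_le_of_finrank_le hle (by rw [U.2.2, W.2.2]))
      exact ⟨.nil, by rw [inf_idem, W.2.2]; simp⟩
    · obtain ⟨U', hadj, hlt⟩ := D.exists_adj_inf_lt U W.2.1 hle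
      have h1 : finrank F (U'.1 ⊓ W.1 : Submodule F V) ≤ P.wittIndex :=
        (Submodule.finrank_mono inf_le_right).trans W.2.2.le
      obtain ⟨p, hp⟩ := ih _ (by omega) U' rfl
      exact ⟨.cons hadj p, by rw [SimpleGraph.Walk.length_cons]; omega⟩

/-- The distance between two generators of the dual polar graph. -/
theorem edist_dualPolarGraph_add_finrank_inf (D : PolarForm P) (U W : P.Generator) :
    P.dualPolarGraph.edist U W + finrank F (U.1 ⊓ W.1 : Submodule F V) = P.wittIndex := by
  obtain ⟨p, hp⟩ := exists_walk_length_add_finrank_inf D U W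
  obtain ⟨r, hr⟩ := p.reachable.exists_walk_length_eq_edist
  have h1 := le_finrank_inf_add_length r
  have h2 := SimpleGraph.edist_le p
  rw [← hr] at h2 ⊢
  norm_cast at h2 ⊢
  omega

theorem finrank_inf_eq_of_edist_eq (D : PolarForm P) {U W X : P.Generator}
    (h : P.dualPolarGraph.edist U X = P.dualPolarGraph.edist W X) :
    finrank F (U.1 ⊓ X.1 : Submodule F V) = finrank F (W.1 ⊓ X.1 : Submodule F V) := by
  obtain ⟨p, -⟩ := exists_walk_length_add_finrank_inf D W X
  obtain ⟨r, hr⟩ := p.reachable.exists_walk_length_eq_edist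
  have h1 := edist_dualPolarGraph_add_finrank_inf D U X
  have h2 := edist_dualPolarGraph_add_finrank_inf D W X
  rw [h] at h1
  rw [← hr] at h1 h2
  norm_cast at h1 h2
  omega

end Generators

end ClassicalPolarSpace

namespace ClassicalPolarSpace

/-! ### Counting isotropic vectors and generators in residues. -/

section Counting

open Module Submodule Finset

open scoped Classical

variable {F V : Type*} [Field F] [AddCommGroup V] [Module F V]

theorem card_filter_mem_submodule [Finite F] [Fintype V] (U : Submodule F V) :
    #{v : V | v ∈ U} = Nat.card F ^ finrank F U := by
  rw [← Module.natCard_eq_pow_finrank (K := F) (V := U), Nat.card_eq_fintype_card,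
    Fintype.card_subtype]

variable {P : ClassicalPolarSpace F V}

namespace PolarForm

/-- Double count of the pairs `(v, t)` with `v + t • u` isotropic. Each `v` has `τ` values of `t`;
for fixed `t`, translation by `t • u` permutes the vectors of `W` outside the perp of `u`. -/
theorem card_iso_notPerp_mul (D : PolarForm P) [Fintype F] [Fintype V] (W : Submodule F V) {u : V}
    (hu : D.Iso u) (huW : u ∈ W) :
    #{v : V | (v ∈ W ∧ D.B u v ≠ 0) ∧ D.Iso v} * Nat.card F =
      #{v : V | v ∈ W ∧ D.B u v ≠ 0} * D.τ := by
  have h := sum_card_bipartiteAbove_eq_sum_card_bipartiteBelow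
    (s := {v : V | v ∈ W ∧ D.B u v ≠ 0}) (t := (univ : Finset F)) (fun v t => D.Iso (v + t • u))
  rw [sum_const_nat (m := D.τ), sum_const_nat (m := #{v : V | (v ∈ W ∧ D.B u v ≠ 0) ∧ D.Iso v})]
    at h
  · rw [h, Finset.card_univ, Nat.card_eq_fintype_card, mul_comm]
  · intro t _
    refine card_nbij' (· + t • u) (· - t • u) ?_ ?_ ?_ ?_
    · intro v hv
      simp only [bipartiteBelow, coe_filter, Finset.mem_filter, Finset.mem_univ, true_and,
        Set.mem_ofPred_eq] at hv ⊢
      refine ⟨⟨W.add_mem hv.1.1 (W.smul_mem t huW), ?_⟩, hv.2⟩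
      simpa [D.self u hu] using hv.1.2
    · intro v hv
      simp only [bipartiteBelow, coe_filter, Finset.mem_filter, Finset.mem_univ, true_and,
        Set.mem_ofPred_eq, sub_add_cancel] at hv ⊢
      refine ⟨⟨W.sub_mem hv.1.1 (W.smul_mem t huW), ?_⟩, hv.2⟩
      simpa [D.self u hu] using hv.1.2
    · intro v _
      simp
    · intro v _
      simp
  · intro v hv
    rw [Finset.mem_filter] at hv
    rw [← D.card_iso u v hu hv.2.2, Nat.card_eq_fintype_card, Fintype.card_subtype]
    rfl

theorem card_filter_notPerp (D : PolarForm P) [Finite F] [Fintype V] (W : Submodule F V) {u : V}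
    (h : ¬ W ≤ LinearMap.ker (D.B u)) :
    (#{v : V | v ∈ W ∧ D.B u v ≠ 0} : ℝ) * Nat.card F =
      (Nat.card F : ℝ) ^ finrank F W * (Nat.card F - 1) := by
  have h1 := finrank_inf_ker_add_one W _ h
  have h2 := card_filter_mem_submodule W
  have h3 := card_filter_mem_submodule (W ⊓ LinearMap.ker (D.B u))
  have h4 : #{v : V | v ∈ W ⊓ LinearMap.ker (D.B u)} + #{v : V | v ∈ W ∧ D.B u v ≠ 0} =
      #{v : V | v ∈ W} := by
    rw [← card_filter_add_card_filter_not (s := {v : V | v ∈ W}) (fun v => D.B u v = 0),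
      filter_filter, filter_filter]
    simp
  rw [h2, h3] at h4
  have h5 : ((Nat.card F : ℝ) ^ finrank F (W ⊓ LinearMap.ker (D.B u) : Submodule F V)) +
      #{v : V | v ∈ W ∧ D.B u v ≠ 0} = (Nat.card F : ℝ) ^ finrank F W := by exact_mod_cast h4
  rw [← h1, pow_succ] at h5 ⊢
  linear_combination (Nat.card F : ℝ) * h5

/-- The number of isotropic vectors outside the perp of an isotropic vector. -/
theorem card_iso_notPerp (D : PolarForm P) [Fintype F] [Fintype V] (W : Submodule F V) {u : V}
    (hu : D.Iso u) (huW : u ∈ W) (h : ¬ W ≤ LinearMap.ker (D.B u)) :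
    (#{v : V | (v ∈ W ∧ D.B u v ≠ 0) ∧ D.Iso v} : ℝ) * (Nat.card F : ℝ) ^ 2 =
      (Nat.card F : ℝ) ^ finrank F W * (Nat.card F - 1) * D.τ := by
  have h1 : (#{v : V | (v ∈ W ∧ D.B u v ≠ 0) ∧ D.Iso v} : ℝ) * Nat.card F =
      #{v : V | v ∈ W ∧ D.B u v ≠ 0} * D.τ := by
    exact_mod_cast D.card_iso_notPerp_mul W hu huW
  linear_combination (Nat.card F : ℝ) * h1 + D.τ * D.card_filter_notPerp W h

/-- Otherwise `T` and the larger `T ⊔ span F {u}` would have the same perp, against `finrank_perp`.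
-/
theorem perp_not_le_ker (D : PolarForm P) [Finite F] [FiniteDimensional F V] {T : Submodule F V}
    (hT : P.IsTotallyIsotropic T) {u : V} (hu : D.Iso u) (hp : u ∈ D.perp T) (h : u ∉ T) :
    ¬ D.perp T ≤ LinearMap.ker (D.B u) := by
  intro hle
  have h1 := D.finrank_perp (D.isTI_sup_span hT hu hp)
  have h2 := D.finrank_perp hT
  rw [finrank_sup_span_singleton h] at h1
  have h3 : D.perp T ≤ D.perp (T ⊔ span F {u}) := by
    intro w hw v hv
    obtain ⟨y, hy, z, hz, rfl⟩ := Submodule.mem_sup.1 hv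
    obtain ⟨c, rfl⟩ := Submodule.mem_span_singleton.1 hz
    have : D.B u w = 0 := hle hw
    simp [hw y hy, this]
  have h4 := Submodule.finrank_mono h3
  omega

theorem card_mem_notMem [Finite F] [Fintype V] {T U : Submodule F V} (h : T ≤ U) :
    (#{v : V | v ∈ U ∧ v ∉ T} : ℝ) =
      (Nat.card F : ℝ) ^ finrank F U - (Nat.card F : ℝ) ^ finrank F T := by
  have h2 := card_filter_mem_submodule U
  have h3 := card_filter_mem_submodule T
  have h4 : #{v : V | v ∈ T} + #{v : V | v ∈ U ∧ v ∉ T} = #{v : V | v ∈ U} := by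
    rw [← card_filter_add_card_filter_not (s := {v : V | v ∈ U}) (fun v => v ∈ T),
      filter_filter, filter_filter]
    congr 2
    ext v
    simpa using @h v
  rw [h2, h3] at h4
  rw [eq_sub_iff_add_eq']
  exact_mod_cast h4

/-- Double count of non-orthogonal pairs `(v, u)` with `v` isotropic in `D.perp T` outside `U`, and
`u` in `U` outside `T`. Both exclusions are automatic for non-orthogonal pairs: `v` is orthogonal to
`T`, and `u` to `U`. -/
theorem card_iso_perp_notMem_generator (D : PolarForm P) [Fintype F] [Fintype V]
    {T : Submodule F V} (U : P.Generator) (h : T ≤ U.1) :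
    (#{v : V | (D.Iso v ∧ v ∈ D.perp T) ∧ v ∉ U.1} : ℝ) *
        ((Nat.card F : ℝ) ^ P.wittIndex * (Nat.card F - 1)) *
          ((Nat.card F : ℝ) ^ finrank F T * Nat.card F) =
      ((Nat.card F : ℝ) ^ P.wittIndex - (Nat.card F : ℝ) ^ finrank F T) *
        ((Nat.card F : ℝ) ^ finrank F V * (Nat.card F - 1) * D.τ) := by
  have : FiniteDimensional F V := Module.Finite.of_finite
  have hT := D.isTI_mono U.2.1 h
  have hU := (D.isTI_iff _).1 U.2.1
  have h0 : (Nat.card F : ℝ) ≠ 0 := Nat.cast_ne_zero.2 Nat.card_pos.ne'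
  have H := sum_card_bipartiteAbove_eq_sum_card_bipartiteBelow
    (s := {v : V | (D.Iso v ∧ v ∈ D.perp T) ∧ v ∉ U.1}) (t := {u : V | u ∈ U.1 ∧ u ∉ T})
    (fun v u => D.B v u ≠ 0)
  have H' := congrArg (Nat.cast : ℕ → ℝ) H
  rw [Nat.cast_sum, Nat.cast_sum] at H'
  rw [sum_eq_card_nsmul
      (b := (Nat.card F : ℝ) ^ P.wittIndex * (Nat.card F - 1) / Nat.card F),
    sum_eq_card_nsmul
      (b := (Nat.card F : ℝ) ^ finrank F (D.perp T) * (Nat.card F - 1) * D.τ / Nat.card F ^ 2),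
    nsmul_eq_mul, nsmul_eq_mul, card_mem_notMem h, U.2.2] at H'
  · have hp := D.finrank_perp hT
    rw [← hp, pow_add]
    field_simp at H'
    linear_combination (Nat.card F : ℝ) ^ finrank F T * H'
  · intro u hu
    rw [Finset.mem_filter] at hu
    have huU := hu.2.1
    have hp : u ∈ D.perp T := fun t ht => hU.2 t (h ht) u huU
    rw [eq_div_iff (pow_ne_zero 2 h0), ← D.card_iso_notPerp (D.perp T) (hU.1 u huU) hp
      (D.perp_not_le_ker hT (hU.1 u huU) hp hu.2.2)]
    congr 3
    ext v
    simp only [bipartiteBelow, Finset.mem_filter, Finset.mem_univ, true_and]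
    constructor
    · rintro ⟨⟨⟨hv1, hv2⟩, -⟩, hv4⟩
      exact ⟨⟨hv2, fun h' => hv4 (D.symm _ _ h')⟩, hv1⟩
    · rintro ⟨⟨hv2, hv4⟩, hv1⟩
      exact ⟨⟨⟨hv1, hv2⟩, fun h' => hv4 (hU.2 u huU v h')⟩, fun h' => hv4 (D.symm _ _ h')⟩
  · intro v hv
    rw [Finset.mem_filter] at hv
    obtain ⟨-, ⟨hv1, hv2⟩, hv3⟩ := hv
    have hc := D.card_filter_notPerp U.1 (D.not_le_ker U hv1 hv3)
    rw [U.2.2] at hc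
    rw [eq_div_iff h0, ← hc]
    congr 3
    ext u
    simp only [bipartiteAbove, Finset.mem_filter, Finset.mem_univ, true_and]
    constructor
    · rintro ⟨⟨hu1, -⟩, hu3⟩
      exact ⟨hu1, hu3⟩
    · rintro ⟨hu1, hu3⟩
      exact ⟨⟨hu1, fun h' => hu3 (D.symm _ _ (hv2 u h'))⟩, hu3⟩

/-- The power `q ^ (d - k + e - 1)`: the residue of a totally isotropic subspace of dimension `k` has
`1 + q ^ (d - k + e - 1)` times as many points as a generator of it. -/
noncomputable def residueParam (D : PolarForm P) (k : ℕ) : ℝ :=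
  D.τ * (Nat.card F : ℝ) ^ finrank F V / (Nat.card F : ℝ) ^ (k + P.wittIndex + 1)

/-- The number of isotropic vectors in the residue of a totally isotropic subspace. -/
theorem card_iso_perp_notMem (D : PolarForm P) [Fintype F] [Fintype V]
    {T : Submodule F V} (hT : P.IsTotallyIsotropic T) :
    (#{v : V | (D.Iso v ∧ v ∈ D.perp T) ∧ v ∉ T} : ℝ) =
      ((Nat.card F : ℝ) ^ P.wittIndex - (Nat.card F : ℝ) ^ finrank F T) *
        (1 + D.residueParam (finrank F T)) := by
  have : FiniteDimensional F V := Module.Finite.of_finite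
  obtain ⟨U, h⟩ := D.exists_generator_ge hT
  have hU := (D.isTI_iff _).1 U.2.1
  have h0 : (Nat.card F : ℝ) ≠ 0 := Nat.cast_ne_zero.2 Nat.card_pos.ne'
  have h1 : (Nat.card F : ℝ) - 1 ≠ 0 :=
    sub_ne_zero.2 (by exact_mod_cast (Finite.one_lt_card (α := F)).ne')
  have H := D.card_iso_perp_notMem_generator U h
  have h2 : #{v : V | (D.Iso v ∧ v ∈ D.perp T) ∧ v ∉ T} = #{v : V | v ∈ U.1 ∧ v ∉ T} +
      #{v : V | (D.Iso v ∧ v ∈ D.perp T) ∧ v ∉ U.1} := by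
    rw [← card_filter_add_card_filter_not
      (s := {v : V | (D.Iso v ∧ v ∈ D.perp T) ∧ v ∉ T}) (fun v => v ∈ U.1),
      filter_filter, filter_filter]
    congr 2 <;> ext v
    · simp only [Finset.mem_filter, Finset.mem_univ, true_and]
      exact ⟨fun hv => ⟨hv.2, hv.1.2⟩, fun hv => ⟨⟨⟨hU.1 v hv.1,
        fun t ht => hU.2 t (h ht) v hv.1⟩, hv.2⟩, hv.1⟩⟩
    · simp only [Finset.mem_filter, Finset.mem_univ, true_and]
      exact ⟨fun hv => ⟨hv.1.1, hv.2⟩, fun hv => ⟨⟨hv.1, fun h' => hv.2 (h h')⟩, hv.2⟩⟩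
  rw [h2, Nat.cast_add, card_mem_notMem h, U.2.2, mul_one_add, residueParam]
  congr 1
  rw [mul_div_assoc', eq_div_iff (pow_ne_zero _ h0)]
  rw [pow_succ, pow_add]
  apply mul_right_cancel₀ h1
  linear_combination H

/-- The number of generators containing a totally isotropic subspace. -/
theorem card_generator_ge (D : PolarForm P) [Fintype F] [Fintype V] (T : Submodule F V)
    (hT : P.IsTotallyIsotropic T) :
    (Nat.card {U : P.Generator // T ≤ U.1} : ℝ) =
      ∏ i ∈ Ico (finrank F T) P.wittIndex, (1 + D.residueParam i) := by
  have : FiniteDimensional F V := Module.Finite.of_finite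
  have h1 : 1 < (Nat.card F : ℝ) := by exact_mod_cast Finite.one_lt_card (α := F)
  suffices H : ∀ m : ℕ, ∀ T : Submodule F V, P.IsTotallyIsotropic T → finrank F T + m = P.wittIndex →
      (Nat.card {U : P.Generator // T ≤ U.1} : ℝ) =
        ∏ i ∈ Ico (finrank F T) P.wittIndex, (1 + D.residueParam i) from
    H _ T hT (Nat.add_sub_cancel' (finrank_le_wittIndex hT))
  intro m
  induction m with
  | zero =>
    intro T hT hd
    rw [add_zero] at hd
    rw [hd, Ico_self, prod_empty, Nat.cast_eq_one, Nat.card_eq_one_iff_exists]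
    refine ⟨⟨⟨T, hT, hd⟩, le_rfl⟩, fun U => Subtype.ext (Subtype.ext ?_)⟩
    exact (Submodule.eq_of_le_of_finrank_eq U.2 (hd.trans U.1.2.2.symm)).symm
  | succ m ih =>
    intro T hT hd
    -- Count pairs `(v, U)` with `v` in `U` and `T ≤ U`: the generators through `T` and `v` are
    -- counted by induction, as `T ⊔ span F {v}` has one dimension more.
    have H := sum_card_bipartiteAbove_eq_sum_card_bipartiteBelow
      (s := {v : V | (D.Iso v ∧ v ∈ D.perp T) ∧ v ∉ T})
      (t := {U : P.Generator | T ≤ U.1}) (fun v U => v ∈ U.1)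
    have H' := congrArg (Nat.cast : ℕ → ℝ) H
    have hpos : (Nat.card F : ℝ) ^ finrank F T < (Nat.card F : ℝ) ^ P.wittIndex :=
      pow_lt_pow_right₀ h1 (by omega)
    rw [Nat.cast_sum, Nat.cast_sum] at H'
    rw [sum_eq_card_nsmul
        (b := ∏ i ∈ Ico (finrank F T + 1) P.wittIndex, (1 + D.residueParam i)),
      sum_eq_card_nsmul
        (b := (Nat.card F : ℝ) ^ P.wittIndex - (Nat.card F : ℝ) ^ finrank F T),
      nsmul_eq_mul, nsmul_eq_mul, D.card_iso_perp_notMem hT] at H'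
    · rw [Nat.card_eq_fintype_card, Fintype.card_subtype]
      rw [prod_eq_prod_Ico_succ_bot (by omega)]
      apply mul_right_cancel₀ (sub_ne_zero.2 hpos.ne')
      rw [← H']
      ring
    · intro U hU
      rw [Finset.mem_filter] at hU
      have hUI := (D.isTI_iff _).1 U.2.1
      have hc := card_mem_notMem hU.2
      rw [U.2.2] at hc
      rw [← hc]
      congr 2
      ext v
      simp only [bipartiteBelow, Finset.mem_filter, Finset.mem_univ, true_and]
      exact ⟨fun hv => ⟨hv.2, hv.1.2⟩, fun hv => ⟨⟨⟨hUI.1 v hv.1,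
        fun t ht => hUI.2 t (hU.2 ht) v hv.1⟩, hv.2⟩, hv.1⟩⟩
    · intro v hv
      rw [Finset.mem_filter] at hv
      obtain ⟨-, ⟨hv1, hv2⟩, hv3⟩ := hv
      have hr := finrank_sup_span_singleton hv3
      rw [← hr, ← ih _ (D.isTI_sup_span hT hv1 hv2) (by omega), Nat.card_eq_fintype_card,
        Fintype.card_subtype]
      congr 2
      ext U
      simp [bipartiteAbove, Submodule.span_le]

end PolarForm

end Counting

end ClassicalPolarSpace

/-! ### Rank and trace of real matrices. -/

namespace Matrix

/-- `A * K` is idempotent of the same rank as `A`, and the trace of a projection is its rank. -/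
theorem cast_rank_eq_trace {m n : Type*} [Fintype m] [Fintype n] (A : Matrix m n ℝ)
    (K : Matrix n m ℝ) (h : A * K * A = A) : (A.rank : ℝ) = (A * K).trace := by
  classical
  have hE : IsIdempotentElem (A * K) := by
    rw [IsIdempotentElem, ← Matrix.mul_assoc, h]
  have hr : (A * K).rank = A.rank := by
    refine le_antisymm (rank_mul_le_left A K) ?_
    conv_lhs => rw [← h]
    exact rank_mul_le_left _ _
  have hL : IsIdempotentElem (toLin' (A * K)) := by
    rw [IsIdempotentElem, Module.End.mul_eq_comp, ← toLin'_mul, hE.eq]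
  rw [← hr, ← trace_toLin'_eq, (LinearMap.IsIdempotentElem.isProj_range _ hL).trace]
  rfl

theorem rank_submatrix_surjective {m n k : Type*} [Fintype n] [Fintype k] (A : Matrix m n ℝ)
    (f : k → n) (hf : Function.Surjective f) : (A.submatrix id f).rank = A.rank := by
  rw [rank_eq_finrank_span_cols, rank_eq_finrank_span_cols]
  have : Set.range (A.submatrix id f).col = Set.range A.col := by
    rw [← hf.range_comp A.col]
    rfl
  rw [this]

theorem exists_finset_span_row {m n : Type*} [Fintype m] [Fintype n] (A : Matrix m n ℝ) :
    ∃ S : Finset m, S.card ≤ A.rank ∧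
      ∀ i, A.row i ∈ Submodule.span ℝ (A.row '' (S : Set m)) := by
  classical
  obtain ⟨b, hb, hspan, hli⟩ := exists_linearIndependent ℝ (Set.range A.row)
  have hfin : b.Finite := (Set.finite_range A.row).subset hb
  have := hfin.fintype
  choose f hf using fun x : b => hb x.2
  refine ⟨Finset.univ.image f, ?_, fun i => ?_⟩
  · refine Finset.card_image_le.trans ?_
    rw [rank_eq_finrank_span_row, ← hspan, finrank_span_set_eq_card hli, Set.toFinset_card,
      Finset.card_univ]
  · refine Submodule.span_mono ?_ (hspan.ge (Submodule.subset_span ⟨i, rfl⟩))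
    intro x hx
    exact ⟨f ⟨x, hx⟩, by simp, hf ⟨x, hx⟩⟩

end Matrix

namespace ClassicalPolarSpace

/-! ### The rank of the incidence matrix and the resolving set. -/

section Incidence

open Module Submodule Finset

open scoped Classical Matrix

variable {F V : Type*} [Field F] [AddCommGroup V] [Module F V] {P : ClassicalPolarSpace F V}

namespace PolarForm

/-- The nonzero isotropic vectors. -/
abbrev IsoVec (D : PolarForm P) : Type _ := {v : V // D.Iso v ∧ v ≠ 0}

theorem isTI_span_singleton (D : PolarForm P) {v : V} (hv : D.Iso v) :
    P.IsTotallyIsotropic (span F {v}) := by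
  simpa using D.isTI_sup_span P.isTotallyIsotropic_bot hv (by simp [mem_perp])

/-- The incidence matrix between generators and nonzero isotropic vectors. -/
noncomputable def vecMatrix (D : PolarForm P) : Matrix P.Generator D.IsoVec ℝ :=
  fun U v => if v.1 ∈ U.1 then 1 else 0

/-- Passing from points to vectors only repeats columns. -/
theorem rank_vecMatrix (D : PolarForm P) [Finite F] [FiniteDimensional F V] [Fintype V] :
    D.vecMatrix.rank = P.incidenceMatrix.rank := by
  rw [← Matrix.rank_submatrix_surjective P.incidenceMatrix
    (fun v : D.IsoVec => (⟨span F {v.1}, D.isTI_span_singleton v.2.1,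
      finrank_span_singleton v.2.2⟩ : P.Point))]
  · congr 1
    ext U v
    simp only [vecMatrix]
    exact if_congr (Submodule.span_singleton_le_iff_mem _ _).symm rfl rfl
  · intro x
    obtain ⟨v, hv, h⟩ := finrank_eq_one_iff'.1 x.2.2
    have hx := (D.isTI_iff _).1 x.2.1
    refine ⟨⟨v.1, hx.1 _ v.2, fun h0 => hv (Subtype.ext h0)⟩, Subtype.ext ?_⟩
    refine le_antisymm ((Submodule.span_singleton_le_iff_mem _ _).2 v.2) fun w hw => ?_
    obtain ⟨c, hc⟩ := h ⟨w, hw⟩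
    exact Submodule.mem_span_singleton.2 ⟨c, congrArg Subtype.val hc⟩

theorem vecMatrix_row_injective (D : PolarForm P) : Function.Injective D.vecMatrix.row := by
  suffices H : ∀ U W : P.Generator, D.vecMatrix.row U = D.vecMatrix.row W → U.1 ≤ W.1 from
    fun U W h => Subtype.ext (le_antisymm (H U W h) (H W U h.symm))
  intro U W h v hv
  by_cases h0 : v = 0
  · exact h0 ▸ W.1.zero_mem
  have h1 := congrFun h ⟨v, ((D.isTI_iff _).1 U.2.1).1 v hv, h0⟩
  by_contra hW
  simp [vecMatrix, Matrix.row, hv, hW] at h1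

theorem residueParam_nonneg (D : PolarForm P) (k : ℕ) : 0 ≤ D.residueParam k := by
  unfold residueParam
  positivity

/-- The number of generators through a point. -/
noncomputable def pointDegree (D : PolarForm P) : ℝ :=
  ∏ i ∈ Ico 1 P.wittIndex, (1 + D.residueParam i)

theorem pointDegree_pos (D : PolarForm P) : 0 < D.pointDegree :=
  prod_pos fun i _ => by linarith [D.residueParam_nonneg i]

/-- The second eigenvalue of the Gram matrix. -/
noncomputable def gramEigenvalue (D : PolarForm P) : ℝ :=
  D.pointDegree / (1 + D.residueParam 1) * (Nat.card F - 1) *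
    ((Nat.card F : ℝ) ^ (P.wittIndex - 1) + D.residueParam 1)

theorem gramEigenvalue_pos (D : PolarForm P) [Finite F] : 0 < D.gramEigenvalue := by
  have h1 : 1 < (Nat.card F : ℝ) := by exact_mod_cast Finite.one_lt_card (α := F)
  have h2 := D.residueParam_nonneg 1
  have h3 := D.pointDegree_pos
  unfold gramEigenvalue
  have : 0 < (Nat.card F : ℝ) - 1 := by linarith
  positivity

variable [Fintype F] [Fintype V]

theorem card_isoVec (D : PolarForm P) : (Fintype.card D.IsoVec : ℝ) =
    ((Nat.card F : ℝ) ^ P.wittIndex - 1) * (1 + D.residueParam 0) := by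
  have h := D.card_iso_perp_notMem P.isTotallyIsotropic_bot
  rw [finrank_bot, pow_zero] at h
  rw [← h, Fintype.card_subtype]
  congr 2
  ext v
  simp [mem_perp]

theorem card_isoVec_mem (D : PolarForm P) (W : Submodule F V) (hW : ∀ v ∈ W, D.Iso v) :
    (#{v : D.IsoVec | v.1 ∈ W} : ℝ) = (Nat.card F : ℝ) ^ finrank F W - 1 := by
  have h := card_mem_notMem (bot_le : ⊥ ≤ W)
  rw [finrank_bot, pow_zero] at h
  rw [← h]
  congr 1
  refine card_nbij Subtype.val ?_ Subtype.val_injective.injOn ?_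
  · intro v hv
    simp only [coe_filter, Finset.mem_univ, true_and, Set.mem_ofPred_eq] at hv ⊢
    exact ⟨hv, v.2.2⟩
  · intro v hv
    simp only [coe_filter, Finset.mem_univ, true_and, Set.mem_ofPred_eq] at hv
    exact ⟨⟨v, hW v hv.1, hv.2⟩, by simpa using hv.1, rfl⟩

theorem sum_vecMatrix_row (D : PolarForm P) (U : P.Generator) :
    ∑ v, D.vecMatrix U v = (Nat.card F : ℝ) ^ P.wittIndex - 1 := by
  have h := D.card_isoVec_mem U.1 ((D.isTI_iff _).1 U.2.1).1
  rw [U.2.2] at h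
  rw [← h]
  simp [vecMatrix]

theorem vecMatrix_row_dotProduct (D : PolarForm P) (U W : P.Generator) :
    D.vecMatrix.row U ⬝ᵥ D.vecMatrix.row W =
      (Nat.card F : ℝ) ^ finrank F (U.1 ⊓ W.1 : Submodule F V) - 1 := by
  rw [← D.card_isoVec_mem (U.1 ⊓ W.1) fun v hv => ((D.isTI_iff _).1 U.2.1).1 v hv.1]
  simp [dotProduct, vecMatrix, Matrix.row, ← ite_and, Submodule.mem_inf, and_comm]

theorem sum_vecMatrix_col (D : PolarForm P) (v : D.IsoVec) :
    ∑ U, D.vecMatrix U v = D.pointDegree := by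
  have h := D.card_generator_ge _ (D.isTI_span_singleton v.2.1)
  rw [finrank_span_singleton v.2.2] at h
  rw [pointDegree, ← h, Nat.card_eq_fintype_card, Fintype.card_subtype]
  simp [vecMatrix]

/-- The number of generators through two points. -/
theorem vecMatrix_gram (D : PolarForm P) (v w : D.IsoVec) :
    (D.vecMatrixᵀ * D.vecMatrix) v w =
      D.pointDegree / (1 + D.residueParam 1) * (if D.B v.1 w.1 = 0 then 1 else 0) +
      (D.pointDegree - D.pointDegree / (1 + D.residueParam 1)) *
        (if w.1 ∈ span F {v.1} then 1 else 0) := by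
  have : FiniteDimensional F V := Module.Finite.of_finite
  have hsum : (D.vecMatrixᵀ * D.vecMatrix) v w =
      Nat.card {U : P.Generator // span F {v.1} ⊔ span F {w.1} ≤ U.1} := by
    rw [Matrix.mul_apply, Nat.card_eq_fintype_card, Fintype.card_subtype]
    simp [vecMatrix, ← ite_and, and_comm]
  rw [hsum]
  have hTI := D.isTI_span_singleton v.2.1
  by_cases hB : D.B v.1 w.1 = 0
  · have hp : w.1 ∈ D.perp (span F {v.1}) := by
      intro x hx
      obtain ⟨c, rfl⟩ := Submodule.mem_span_singleton.1 hx
      simp [hB]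
    rw [D.card_generator_ge _ (D.isTI_sup_span hTI w.2.1 hp)]
    by_cases hw : w.1 ∈ span F {v.1}
    · rw [sup_eq_left.2 ((Submodule.span_singleton_le_iff_mem _ _).2 hw),
        finrank_span_singleton v.2.2, if_pos hB, if_pos hw, pointDegree]
      ring
    · have hd := finrank_le_wittIndex (D.isTI_sup_span hTI w.2.1 hp)
      rw [finrank_sup_span_singleton hw, finrank_span_singleton v.2.2] at hd ⊢
      have hprod : D.pointDegree = (1 + D.residueParam 1) *
          ∏ i ∈ Ico (1 + 1) P.wittIndex, (1 + D.residueParam i) :=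
        prod_eq_prod_Ico_succ_bot (by omega) _
      rw [if_pos hB, if_neg hw, hprod]
      have := D.residueParam_nonneg 1
      field_simp
      ring
  · have hw : w.1 ∉ span F {v.1} := by
      intro hw
      obtain ⟨c, hc⟩ := Submodule.mem_span_singleton.1 hw
      exact hB (by rw [← hc, map_smul, D.self _ v.2.1, smul_zero])
    have : IsEmpty {U : P.Generator // span F {v.1} ⊔ span F {w.1} ≤ U.1} := by
      refine ⟨fun U => hB (((D.isTI_iff _).1 U.1.2.1).2 _ (U.2 ?_) _ (U.2 ?_))⟩
      · exact Submodule.mem_sup_left (Submodule.mem_span_singleton_self _)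
      · exact Submodule.mem_sup_right (Submodule.mem_span_singleton_self _)
    rw [if_neg hB, if_neg hw, Nat.card_of_isEmpty]
    simp

/-- The sum counts the vectors of `U` orthogonal to `v` and those on the line of `v`: `q ^ d - 1`
and `q - 1` if `v` lies in `U`, and `q ^ (d - 1) - 1` and `0` otherwise. -/
theorem gram_mul_vecMatrix_transpose (D : PolarForm P) (hd : 1 ≤ P.wittIndex) (v : D.IsoVec)
    (U : P.Generator) :
    ∑ w, (D.vecMatrixᵀ * D.vecMatrix) v w * D.vecMatrix U w =
      D.gramEigenvalue * D.vecMatrix U v +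
        D.pointDegree / (1 + D.residueParam 1) * ((Nat.card F : ℝ) ^ (P.wittIndex - 1) - 1) := by
  have : FiniteDimensional F V := Module.Finite.of_finite
  have hU := (D.isTI_iff _).1 U.2.1
  have hA := D.card_isoVec_mem (U.1 ⊓ LinearMap.ker (D.B v.1)) fun w hw => hU.1 w hw.1
  have hL := D.card_isoVec_mem (U.1 ⊓ span F {v.1}) fun w hw => hU.1 w hw.1
  have hsum : ∑ w, (D.vecMatrixᵀ * D.vecMatrix) v w * D.vecMatrix U w =
      D.pointDegree / (1 + D.residueParam 1) *
        #{w : D.IsoVec | w.1 ∈ U.1 ⊓ LinearMap.ker (D.B v.1)} +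
      (D.pointDegree - D.pointDegree / (1 + D.residueParam 1)) *
        #{w : D.IsoVec | w.1 ∈ U.1 ⊓ span F {v.1}} := by
    rw [← sum_boole, ← sum_boole, mul_sum, mul_sum, ← sum_add_distrib]
    refine sum_congr rfl fun w _ => ?_
    rw [vecMatrix_gram]
    by_cases h1 : w.1 ∈ U.1 <;> simp [vecMatrix, h1]
  have hq : (Nat.card F : ℝ) ^ P.wittIndex =
      (Nat.card F : ℝ) ^ (P.wittIndex - 1) * Nat.card F := by
    rw [← pow_succ, Nat.sub_add_cancel hd]
  have h1 := D.residueParam_nonneg 1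
  have h2 : D.pointDegree - D.pointDegree / (1 + D.residueParam 1) =
      D.pointDegree / (1 + D.residueParam 1) * D.residueParam 1 := by
    field_simp
    ring
  rw [hsum, hA, hL, gramEigenvalue, h2]
  by_cases hv : v.1 ∈ U.1
  · have e1 : U.1 ⊓ LinearMap.ker (D.B v.1) = U.1 :=
      inf_eq_left.2 fun w hw => hU.2 _ hv _ hw
    have e2 : U.1 ⊓ span F {v.1} = span F {v.1} :=
      inf_eq_right.2 ((Submodule.span_singleton_le_iff_mem _ _).2 hv)
    rw [e1, e2, finrank_span_singleton v.2.2, U.2.2, hq, vecMatrix, if_pos hv]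
    ring
  · have e1 := finrank_inf_ker_add_one U.1 _ (D.not_le_ker U v.2.1 hv)
    have e2 : U.1 ⊓ span F {v.1} = ⊥ :=
      disjoint_iff.1 ((Submodule.disjoint_span_singleton' v.2.2).2 hv)
    rw [U.2.2] at e1
    rw [e2, finrank_bot, Nat.eq_sub_of_add_eq e1, vecMatrix, if_neg hv]
    ring

theorem cast_rank_vecMatrix (D : PolarForm P) (hd : 1 ≤ P.wittIndex) :
    (D.vecMatrix.rank : ℝ) =
      (1 + D.residueParam 0) * ((1 + D.residueParam 1) * ((Nat.card F : ℝ) ^ P.wittIndex - 1) -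
          ((Nat.card F : ℝ) ^ (P.wittIndex - 1) - 1)) /
        ((Nat.card F - 1) * ((Nat.card F : ℝ) ^ (P.wittIndex - 1) + D.residueParam 1)) := by
  have h1 : 1 < (Nat.card F : ℝ) := by exact_mod_cast Finite.one_lt_card (α := F)
  have h2 : 0 < (Nat.card F : ℝ) ^ P.wittIndex - 1 := sub_pos.2 (one_lt_pow₀ h1 (by omega))
  have h3 := D.residueParam_nonneg 1
  have hg := D.pointDegree_pos
  have hlam := D.gramEigenvalue_pos
  set κ : ℝ := D.pointDegree / (1 + D.residueParam 1) *
    ((Nat.card F : ℝ) ^ (P.wittIndex - 1) - 1) with hκ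
  -- Chosen so that the constant term `κ / λ` cancels against `γ` times the column sum times the row
  -- sum of the matrix.
  set γ : ℝ := κ / (D.gramEigenvalue * D.pointDegree * ((Nat.card F : ℝ) ^ P.wittIndex - 1))
    with hγ
  let K : Matrix P.Generator D.IsoVec ℝ := fun U v => D.gramEigenvalue⁻¹ * D.vecMatrix U v - γ
  have hE : ∀ v w, (D.vecMatrixᵀ * K) v w =
      D.gramEigenvalue⁻¹ * (D.vecMatrixᵀ * D.vecMatrix) v w - γ * D.pointDegree := by
    intro v w
    rw [← D.sum_vecMatrix_col v, Matrix.mul_apply, Matrix.mul_apply, mul_sum, mul_sum,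
      ← sum_sub_distrib]
    refine sum_congr rfl fun U _ => ?_
    rw [Matrix.transpose_apply]
    ring
  have hK : D.vecMatrixᵀ * K * D.vecMatrixᵀ = D.vecMatrixᵀ := by
    ext v U
    rw [Matrix.mul_apply]
    have : ∑ w, (D.vecMatrixᵀ * K) v w * D.vecMatrixᵀ w U =
        D.gramEigenvalue⁻¹ * ∑ w, (D.vecMatrixᵀ * D.vecMatrix) v w * D.vecMatrix U w -
          γ * D.pointDegree * ∑ w, D.vecMatrix U w := by
      rw [mul_sum, mul_sum, ← sum_sub_distrib]
      refine sum_congr rfl fun w _ => ?_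
      rw [hE, Matrix.transpose_apply]
      ring
    rw [this, D.gram_mul_vecMatrix_transpose hd, D.sum_vecMatrix_row, Matrix.transpose_apply, hγ,
      ← hκ]
    field_simp
    ring
  rw [← Matrix.rank_transpose, Matrix.cast_rank_eq_trace _ K hK, Matrix.trace]
  -- The diagonal is constant, so the trace is this value times the number of isotropic vectors.
  have hdiag : ∀ v, (D.vecMatrixᵀ * K).diag v =
      D.gramEigenvalue⁻¹ * D.pointDegree - γ * D.pointDegree := by
    intro v
    rw [Matrix.diag_apply, hE, vecMatrix_gram, if_pos (D.self _ v.2.1),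
      if_pos (Submodule.mem_span_singleton_self _)]
    ring
  rw [sum_congr rfl fun v _ => hdiag v, sum_const, Finset.card_univ, nsmul_eq_mul, D.card_isoVec,
    hγ, hκ, gramEigenvalue]
  have h4 : (Nat.card F : ℝ) - 1 ≠ 0 := by linarith
  have h5 : (Nat.card F : ℝ) ^ (P.wittIndex - 1) + D.residueParam 1 ≠ 0 := by positivity
  have h6 : 1 + D.residueParam 1 ≠ 0 := by positivity
  field_simp

theorem metricDimension_le_rank (D : PolarForm P) :
    letI : FiniteDimensional F V := Module.Finite.of_finite
    metricDimension P.dualPolarGraph ≤ D.vecMatrix.rank := by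
  have : FiniteDimensional F V := Module.Finite.of_finite
  obtain ⟨S, hS, hspan⟩ := D.vecMatrix.exists_finset_span_row
  refine le_trans (Nat.sInf_le ⟨S, fun U W hne => ?_, rfl⟩) hS
  by_contra! H
  refine hne (D.vecMatrix_row_injective ?_)
  -- Equal distances to `S` make the difference of the two rows orthogonal to the whole row space,
  -- which contains that difference.
  have h0 : ∀ r ∈ span ℝ (D.vecMatrix.row '' (S : Set P.Generator)),
      (D.vecMatrix.row U - D.vecMatrix.row W) ⬝ᵥ r = 0 := by
    intro r hr
    induction hr using Submodule.span_induction with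
    | mem x hx =>
      obtain ⟨X, hX, rfl⟩ := hx
      rw [sub_dotProduct, vecMatrix_row_dotProduct, vecMatrix_row_dotProduct,
        finrank_inf_eq_of_edist_eq D (H X hX), sub_self]
    | zero => exact dotProduct_zero _
    | add x y _ _ hx hy => rw [dotProduct_add, hx, hy, add_zero]
    | smul c x _ hx => rw [dotProduct_smul, hx, smul_zero]
  exact sub_eq_zero.1 (dotProduct_self_eq_zero.1 (h0 _ (sub_mem (hspan U) (hspan W))))

end PolarForm

end Incidence

end ClassicalPolarSpace

namespace ClassicalPolarSpace

/-! ### Relating `τ` to the parameter `e`. -/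

section Parameter

open Module

variable {F V : Type*} [Field F] [Finite F] [AddCommGroup V] [Module F V] [FiniteDimensional F V]

/-- Every vector is isotropic, so a generator equals its own perp. -/
theorem two_mul_wittIndex_symplectic (B : LinearMap.BilinForm F V) (alt : LinearMap.IsAlt B)
    (nondeg : LinearMap.Nondegenerate B) :
    2 * (symplectic B alt nondeg).wittIndex = finrank F V := by
  let D := symplecticPolarForm B alt nondeg
  obtain ⟨U⟩ := nonempty_generator (symplectic B alt nondeg)
  have h1 := D.finrank_perp U.2.1
  have h2 : D.perp U.1 = U.1 :=
    le_antisymm (fun v hv => D.mem_of_mem_perp U trivial hv) (D.le_perp U.2.1)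
  rw [h2, U.2.2] at h1
  omega

/-- This says `q ^ e = τ * q ^ (n - 2d)`, with `τ` equal to `q`, `1` and `√q` in the symplectic,
orthogonal and Hermitian cases. -/
theorem exists_polarForm (P : ClassicalPolarSpace F V) :
    ∃ D : PolarForm P, (Nat.card F : ℝ) ^ P.parameterE * (Nat.card F : ℝ) ^ (2 * P.wittIndex) =
      D.τ * (Nat.card F : ℝ) ^ finrank F V := by
  have h0 : 0 < (Nat.card F : ℝ) := Nat.cast_pos.2 Nat.card_pos
  have hsub : ∀ d : ℕ, (Nat.card F : ℝ) ^ ((finrank F V : ℝ) - 2 * d) *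
      (Nat.card F : ℝ) ^ (2 * d) = (Nat.card F : ℝ) ^ finrank F V := by
    intro d
    rw [← Real.rpow_natCast, ← Real.rpow_natCast, ← Real.rpow_add h0]
    congr 1
    push_cast
    ring
  cases P with
  | symplectic B alt nondeg =>
    refine ⟨symplecticPolarForm B alt nondeg, ?_⟩
    rw [two_mul_wittIndex_symplectic, parameterE, Real.rpow_one]
    rfl
  | orthogonal Q nondeg =>
    refine ⟨orthogonalPolarForm Q nondeg, ?_⟩
    rw [parameterE, hsub]
    simp [orthogonalPolarForm]
  | hermitian σ σ_ne σ_invol H herm nondeg =>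
    refine ⟨hermitianPolarForm σ σ_ne σ_invol H herm nondeg, ?_⟩
    have hτ : (Nat.card F : ℝ) ^ (1 / 2 : ℝ) = Nat.card {s : F // s + σ s = 0} := by
      rw [← card_trace_ker_sq σ σ_ne σ_invol, ← Real.sqrt_eq_rpow]
      push_cast
      exact Real.sqrt_sq (Nat.cast_nonneg _)
    rw [parameterE, Real.rpow_add h0, mul_right_comm, hsub, hτ, mul_comm]
    rfl

end Parameter

end ClassicalPolarSpace

theorem theorem2p4 {F V : Type*} [Field F] [Finite F] [AddCommGroup V] [Module F V]
    [FiniteDimensional F V] (P : ClassicalPolarSpace F V) (q d : ℕ) (e : ℝ)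
    (hq : q = Nat.card F) (hd : d = P.wittIndex) (hd_pos : 1 ≤ d) (he : e = P.parameterE) :
    metricDimension P.dualPolarGraph ≤ P.incidenceMatrix.rank ∧
    (P.incidenceMatrix.rank : ℝ) =
      (((q : ℝ) ^ ((d : ℝ) + e - 1) + 1) *
          ((q : ℝ) ^ ((d : ℝ) + e - 1) - (q : ℝ) ^ (e - 1) + (q : ℝ) - 1)) /
        (((q : ℝ) ^ (e - 1) + 1) * ((q : ℝ) - 1)) ∧
    (metricDimension P.dualPolarGraph : ℝ) ≤
      (((q : ℝ) ^ ((d : ℝ) + e - 1) + 1) *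
          ((q : ℝ) ^ ((d : ℝ) + e - 1) - (q : ℝ) ^ (e - 1) + (q : ℝ) - 1)) /
        (((q : ℝ) ^ (e - 1) + 1) * ((q : ℝ) - 1)) := by
  have : Finite V := Module.finite_of_finite F
  have := Fintype.ofFinite F
  have := Fintype.ofFinite V
  obtain ⟨D, hD⟩ := P.exists_polarForm
  have hle : metricDimension P.dualPolarGraph ≤ P.incidenceMatrix.rank :=
    D.metricDimension_le_rank.trans_eq D.rank_vecMatrix
  have hrank := D.cast_rank_vecMatrix (hd ▸ hd_pos)
  rw [D.rank_vecMatrix, ClassicalPolarSpace.PolarForm.residueParam,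
    ClassicalPolarSpace.PolarForm.residueParam, ← hD, ← hq, ← hd, ← he] at hrank
  have hq1 : 1 < (q : ℝ) := by
    rw [hq]
    exact_mod_cast Finite.one_lt_card (α := F)
  have hq0 : 0 < (q : ℝ) := by linarith
  have hformula : (P.incidenceMatrix.rank : ℝ) =
      (((q : ℝ) ^ ((d : ℝ) + e - 1) + 1) *
          ((q : ℝ) ^ ((d : ℝ) + e - 1) - (q : ℝ) ^ (e - 1) + (q : ℝ) - 1)) /
        (((q : ℝ) ^ (e - 1) + 1) * ((q : ℝ) - 1)) := by
    obtain ⟨c, rfl⟩ := Nat.exists_eq_add_of_le' hd_pos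
    have hx : 0 < (q : ℝ) ^ (e - 1) := Real.rpow_pos_of_pos hq0 _
    have h1 : (q : ℝ) ^ (((c + 1 : ℕ) : ℝ) + e - 1) = (q : ℝ) ^ c * q * (q : ℝ) ^ (e - 1) := by
      rw [← pow_succ, ← Real.rpow_natCast, ← Real.rpow_add hq0]
      congr 1
      ring
    have h2 : (q : ℝ) ^ e = (q : ℝ) ^ (e - 1) * q := by
      rw [← Real.rpow_add_one hq0.ne', sub_add_cancel]
    have hy : 0 < (q : ℝ) ^ c := pow_pos hq0 c
    -- With `d = c + 1`, the residue parameters at `0` and `1` are `q ^ (d + e - 1)` and `q ^ (d + e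
    -- - 2)`.
    have e1 : (q : ℝ) ^ (e - 1) * q * (q : ℝ) ^ (2 * (c + 1)) / (q : ℝ) ^ (0 + (c + 1) + 1) =
        (q : ℝ) ^ c * q * (q : ℝ) ^ (e - 1) := by
      rw [div_eq_iff (by positivity)]
      ring
    have e2 : (q : ℝ) ^ (e - 1) * q * (q : ℝ) ^ (2 * (c + 1)) / (q : ℝ) ^ (1 + (c + 1) + 1) =
        (q : ℝ) ^ c * (q : ℝ) ^ (e - 1) := by
      rw [div_eq_iff (by positivity)]
      ring
    have hq2 : (q : ℝ) - 1 ≠ 0 := by linarith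
    rw [hrank, h1, h2, e1, e2, Nat.add_sub_cancel, pow_succ]
    generalize (q : ℝ) ^ (e - 1) = x at hx
    generalize (q : ℝ) ^ c = y at hy
    rw [div_eq_div_iff (by positivity) (by positivity)]
    ring
  exact ⟨hle, hformula, hformula ▸ Nat.cast_le.2 hle⟩
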